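/- Let $K$ be a field, let $K^\times=K\setminus\{0\}$, and let $\mathcal R\subseteq K^\times$ be a set containing $1$ and exactly one element of each coset of $(K^\times)^3=\{b^3: b\in K^\times\}$ in $K^\times$. Then $SL_3(K)$ is generated by the matrices $$\hat R(a)=\begin{pmatrix}a&0&0\\0&1&0\\0&0&a^{-1}\end{pmatrix}\ (a\in K^\times\setminus\{1\}),\quad \hat S=\begin{pmatrix}-1&1&0\\0&1&0\\0&0&-1\end{pmatrix},\quad \hat J=\begin{pmatrix}0&-1&0\\-1&0&0\\0&0&-1\end{pmatrix},\quad T=\begin{pmatrix}0&0&-1\\0&-1&0\\-1&0&0\end{pmatrix},$$ and, in terms of these generators, the following is a system of defining relations for $SL_3(K)$; that is, the kernel of the homomorphism onto $SL_3(K)$ from the free group on symbols $\hat R(a)$ $(a\in K^\times\setminus\{1\})$, $\hat S$, $\hat J$, $T$, sending each symbol to the matrix of the same name, is the normal closure of the elements $uv^{-1}$ for the relations $u=v$ in the list: (i) $\hat S^2=\hat J^2=T^2=1$; (ii) $\hat R(a)\hat R(b)=\hat R(ab)$ for $a,b\in K^\times\setminus\{1\}$; (iii) $\hat Z(a)\hat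 Z(b)=\hat Z(ab)$ for $a,b\in K^\times\setminus\{1\}$; (iv) $[\hat R(a),\hat Z(b)]=1$ for $a,b\in K^\times\setminus\{1\}$; (v) $[\hat S,\hat Z(a)]=1$ for $a\in K^\times\setminus\{1\}$; (vi) $[\hat S,\hat R(a)]=\hat E_{1,2}(1-a)$ for $a\in K^\times\setminus\{1\}$; (vii) $(\hat J\hat S)^3=(T\hat J)^3=1$; (viii) $(T\hat R(a))^2=1$ for $a\in K^\times\setminus\{1\}$; (ix) $[\hat Z(a),T]=\hat R(a)^3$ for $a\in K^\times\setminus\{1\}$; (x) $(\hat W\hat E_{1,2}(a))^2=1$ for $a\in\mathcal R$; (xi) $\hat W\hat J\hat R(a)\hat W=\rho_a\hat W\lambda_a$ for $a\in\mathcal R$. Here $[x,y]=xyx^{-1}y^{-1}$; $\hat R(1):=1$ and $\hat Z(1):=1$; $\hat Z(a):=(\hat J\hat R(a))^2$ for $a\in K^\times\setminus\{1\}$; $\hat E_{1,2}(a):=\hat R(a)\hat S\hat R(-a)^{-1}$ for $a\in K^\times$; $\hat W:=T\hat ST$; $\rho_a:=\hat E_{1,2}(-a)\hat J\hat R(a)$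 and $\lambda_a:=\hat E_{1,2}(-a^{-2})\hat J\hat E_{1,2}(a^2)\hat R(a)^4\hat Z(a)^{-2}$ for $a\in K^\times$. -/

import Mathlib

open scoped MatrixGroups commutatorElement

namespace SL3Pres

/-- The formal generators: one symbol `R a` for each `a ∈ Kˣ \ {1}`, and `S`, `J`, `T`. -/
inductive Gen (K : Type*) [Field K] : Type _
  | R (a : Kˣ) (ha : a ≠ 1) : Gen K
  | S : Gen K
  | J : Gen K
  | T : Gen K

/-! ### The matrices in `SL₃(K)` -/

/-- The diagonal matrix `diag(a, 1, a⁻¹)`. -/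
def matR {K : Type*} [Field K] (a : Kˣ) : SL(3, K) :=
  ⟨!![(a : K), 0, 0; 0, 1, 0; 0, 0, (a : K)⁻¹], by simp [Matrix.det_fin_three]⟩

def matS (K : Type*) [Field K] : SL(3, K) :=
  ⟨!![-1, 1, 0; 0, 1, 0; 0, 0, -1], by simp [Matrix.det_fin_three]⟩

def matJ (K : Type*) [Field K] : SL(3, K) :=
  ⟨!![0, -1, 0; -1, 0, 0; 0, 0, -1], by simp [Matrix.det_fin_three]⟩

def matT (K : Type*) [Field K] : SL(3, K) :=
  ⟨!![0, 0, -1; 0, -1, 0; -1, 0, 0], by simp [Matrix.det_fin_three]⟩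

/-- The matrix named by each formal generator. -/
def Gen.toSL {K : Type*} [Field K] : Gen K → SL(3, K)
  | .R a _ => matR a
  | .S => matS K
  | .J => matJ K
  | .T => matT K

/-! ### Words in the free group on the formal generators -/

open Classical in
/-- The word `R(a)`, with the convention `R(1) = 1`. -/
noncomputable def wR {K : Type*} [Field K] (a : Kˣ) : FreeGroup (Gen K) :=
  if ha : a = 1 then 1 else FreeGroup.of (Gen.R a ha)

def wS (K : Type*) [Field K] : FreeGroup (Gen K) := FreeGroup.of Gen.S

def wJ (K : Type*) [Field K] : FreeGroup (Gen K) := FreeGroup.of Gen.J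

def wT (K : Type*) [Field K] : FreeGroup (Gen K) := FreeGroup.of Gen.T

/-- The word `Z(a) = (J R(a))²` for `a ≠ 1`, with the convention `Z(1) = 1`. -/
noncomputable def wZ {K : Type*} [Field K] (a : Kˣ) : FreeGroup (Gen K) :=
  open Classical in if a = 1 then 1 else (wJ K * wR a) ^ 2

/-- The word `E₁₂(a) = R(a) S R(-a)⁻¹`. -/
noncomputable def wE {K : Type*} [Field K] (a : Kˣ) : FreeGroup (Gen K) :=
  wR a * wS K * (wR (-a))⁻¹

/-- The word `W = T S T`. -/
def wW (K : Type*) [Field K] : FreeGroup (Gen K) := wT K * wS K * wT K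

/-- The word `ρ_a = E₁₂(-a) J R(a)`. -/
noncomputable def wRho {K : Type*} [Field K] (a : Kˣ) : FreeGroup (Gen K) :=
  wE (-a) * wJ K * wR a

/-- The word `λ_a = E₁₂(-a⁻²) J E₁₂(a²) R(a)⁴ Z(a)⁻²`. -/
noncomputable def wLambda {K : Type*} [Field K] (a : Kˣ) : FreeGroup (Gen K) :=
  wE (-(a ^ 2)⁻¹) * wJ K * wE (a ^ 2) * wR a ^ 4 * (wZ a ^ 2)⁻¹

/-- The element `1 - a` of `Kˣ`, for `a ∈ Kˣ \ {1}`. -/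
def oneSub {K : Type*} [Field K] (a : Kˣ) (ha : a ≠ 1) : Kˣ :=
  Units.mk0 (1 - (a : K)) (sub_ne_zero.mpr fun h => ha (Units.ext h.symm))

/-- `Rel 𝓡 u v` says that `u = v` is one of the listed relations; commutators are
`⁅x, y⁆ = x * y * x⁻¹ * y⁻¹`. -/
inductive Rel {K : Type*} [Field K] (𝓡 : Set Kˣ) : FreeGroup (Gen K) → FreeGroup (Gen K) → Prop
  | S_sq : Rel 𝓡 (wS K ^ 2) 1
  | J_sq : Rel 𝓡 (wJ K ^ 2) 1
  | T_sq : Rel 𝓡 (wT K ^ 2) 1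
  | R_mul (a b : Kˣ) (ha : a ≠ 1) (hb : b ≠ 1) : Rel 𝓡 (wR a * wR b) (wR (a * b))
  | Z_mul (a b : Kˣ) (ha : a ≠ 1) (hb : b ≠ 1) : Rel 𝓡 (wZ a * wZ b) (wZ (a * b))
  | comm_R_Z (a b : Kˣ) (ha : a ≠ 1) (hb : b ≠ 1) : Rel 𝓡 ⁅wR a, wZ b⁆ 1
  | comm_S_Z (a : Kˣ) (ha : a ≠ 1) : Rel 𝓡 ⁅wS K, wZ a⁆ 1
  | comm_S_R (a : Kˣ) (ha : a ≠ 1) : Rel 𝓡 ⁅wS K, wR a⁆ (wE (oneSub a ha))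
  | JS_cube : Rel 𝓡 ((wJ K * wS K) ^ 3) 1
  | TJ_cube : Rel 𝓡 ((wT K * wJ K) ^ 3) 1
  | TR_sq (a : Kˣ) (ha : a ≠ 1) : Rel 𝓡 ((wT K * wR a) ^ 2) 1
  | comm_Z_T (a : Kˣ) (ha : a ≠ 1) : Rel 𝓡 ⁅wZ a, wT K⁆ (wR a ^ 3)
  | WE_sq (a : Kˣ) (ha : a ∈ 𝓡) : Rel 𝓡 ((wW K * wE a) ^ 2) 1
  | WJRW (a : Kˣ) (ha : a ∈ 𝓡) :
      Rel 𝓡 (wW K * wJ K * wR a * wW K) (wRho a * wW K * wLambda a)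

/-- The relators `u * v⁻¹`, one for each relation `u = v`. -/
def relators {K : Type*} [Field K] (𝓡 : Set Kˣ) : Set (FreeGroup (Gen K)) :=
  {w | ∃ u v, Rel 𝓡 u v ∧ w = u * v⁻¹}

/-- `𝓡` is a set of representatives (exactly one in each class) for `Kˣ / (Kˣ)³`. -/
def IsCubeReps {K : Type*} [Field K] (𝓡 : Set Kˣ) : Prop :=
  Set.BijOn (fun a : Kˣ => (a : Kˣ ⧸ (powMonoidHom 3 : Kˣ →* Kˣ).range)) 𝓡 Set.univ

end SL3Pres

/-!
Let `G` be the presented group. The relations are easily seen to hold in `SL₃(K)` and the matrices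
to generate it, so everything rests on the injectivity of `G → SL₃(K)`, which is proved along a
chain of subgroups `borel ≤ levi ≤ parabolic ≤ G`. If `P ≤ G` maps injectively, `t` is an
involution and `t P t⁻¹ ⊆ P ∪ P t P`, then `P` and `t` generate `P ∪ P t P`; this subgroup maps
injectively too, provided that the image of `t` is not in the image of `P`. This takes `borel` to
`levi` with `t = J`, and `parabolic` to `G` with `t = T`.

Between the two, `parabolic` is the semidirect product of `levi` with the abelian group of the
root elements `x₃₁ u` and `x₃₂ v`. The Chevalley commutator formulas needed for this are only
listed for parameters in `𝓡`, as (x) and (xi), but conjugation by the torus changes the parameter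
by an arbitrary cube. In (xi), the commutator formula holds up to a factor in `levi`, which maps
to `1` and is therefore trivial.
-/

namespace SL3Pres

section Group

variable {G H : Type*} [Group G] [Group H]

theorem mem_or_mem_doubleCoset_of_mem_closure_insert {P : Subgroup G} {t : G} (ht : t * t = 1)
    (hP : ∀ p ∈ P, t * p * t⁻¹ ∈ P ∨ t * p * t⁻¹ ∈ DoubleCoset.doubleCoset t P P) {g : G}
    (hg : g ∈ Subgroup.closure (insert t (P : Set G))) :
    g ∈ P ∨ g ∈ DoubleCoset.doubleCoset t P P := by
  have left_mul {p g : G} (hp : p ∈ P) (hg : g ∈ P ∨ g ∈ DoubleCoset.doubleCoset t P P) :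
      p * g ∈ P ∨ p * g ∈ DoubleCoset.doubleCoset t P P := by
    simp only [DoubleCoset.mem_doubleCoset, SetLike.mem_coe] at hg ⊢
    rcases hg with hg | ⟨q, hq, r, hr, rfl⟩
    · exact .inl (mul_mem hp hg)
    · exact .inr ⟨p * q, mul_mem hp hq, r, hr, by group⟩
  have t_mul {g : G} (hg : g ∈ P ∨ g ∈ DoubleCoset.doubleCoset t P P) :
      t * g ∈ P ∨ t * g ∈ DoubleCoset.doubleCoset t P P := by
    have hP := hP
    simp only [DoubleCoset.mem_doubleCoset, SetLike.mem_coe] at hg hP ⊢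
    rcases hg with hg | ⟨q, hq, r, hr, rfl⟩
    · exact .inr ⟨1, one_mem P, g, hg, by group⟩
    have hqr : t * (q * t * r) = t * q * t⁻¹ * r := by
      rw [inv_eq_of_mul_eq_one_left ht]; group
    rw [hqr]
    rcases hP q hq with h | ⟨x, hx, y, hy, h⟩
    · exact .inl (mul_mem h hr)
    · exact .inr ⟨x, hx, y * r, mul_mem hy hr, by rw [h]; group⟩
  induction hg using Subgroup.closure_induction_left with
  | one => exact .inl (one_mem P)
  | mul_left x hx g _ ih =>
    rcases hx with rfl | hx
    exacts [t_mul ih, left_mul hx ih]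
  | inv_mul_cancel x hx g _ ih =>
    rcases hx with rfl | hx
    exacts [(inv_eq_of_mul_eq_one_left ht).symm ▸ t_mul ih, left_mul (inv_mem hx) ih]

theorem disjoint_closure_insert_ker (f : G →* H) {P : Subgroup G} {t : G} (ht : t * t = 1)
    (hP : ∀ p ∈ P, t * p * t⁻¹ ∈ P ∨ t * p * t⁻¹ ∈ DoubleCoset.doubleCoset t P P)
    (hker : Disjoint P f.ker) (hft : f t ∉ P.map f) :
    Disjoint (Subgroup.closure (insert t (P : Set G))) f.ker := by
  rw [Subgroup.disjoint_def] at hker ⊢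
  intro g hg hgf
  rcases mem_or_mem_doubleCoset_of_mem_closure_insert ht hP hg with hg | hg
  · exact hker hg hgf
  · obtain ⟨p, hp, q, hq, rfl⟩ := DoubleCoset.mem_doubleCoset.mp hg
    refine absurd ⟨p⁻¹ * q⁻¹, mul_mem (inv_mem hp) (inv_mem hq), ?_⟩ hft
    rw [MonoidHom.mem_ker, map_mul, map_mul, mul_eq_one_iff_eq_inv] at hgf
    rw [map_mul, map_inv, map_inv, ← hgf, inv_mul_cancel_left]

theorem conj_mem_doubleCoset_of_braid {P : Subgroup G} {t m d d' : G} (hm : m ∈ P)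
    (hbraid : t * m * t⁻¹ = m * t * m) (hd : t * d * t⁻¹ ∈ P) (hd' : t * d' * t⁻¹ ∈ P) :
    t * (d * m * d') * t⁻¹ ∈ DoubleCoset.doubleCoset t P P :=
  DoubleCoset.mem_doubleCoset.mpr ⟨_, mul_mem hd hm, _, mul_mem hm hd', by
    calc t * (d * m * d') * t⁻¹ = t * d * t⁻¹ * (t * m * t⁻¹) * (t * d' * t⁻¹) := by group
      _ = _ := by rw [hbraid]; group⟩

theorem disjoint_sup_ker (f : G →* H) {N L : Subgroup G} (hLN : L ≤ Subgroup.normalizer (N : Set G))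
    (hN : Disjoint N f.ker) (hL : Disjoint L f.ker) (hNL : Disjoint (N.map f) (L.map f)) :
    Disjoint (N ⊔ L) f.ker := by
  rw [Subgroup.disjoint_def] at hN hL hNL ⊢
  intro g hg hgf
  rw [← SetLike.mem_coe, Subgroup.coe_mul_of_right_le_normalizer_left N L hLN] at hg
  obtain ⟨n, hn, l, hl, rfl⟩ := hg
  have hnl : f n * f l = 1 := by simpa using hgf
  have hfn : f n = 1 := hNL ⟨n, hn, rfl⟩ <| by
    rw [eq_inv_of_mul_eq_one_left hnl]
    exact inv_mem ⟨l, hl, rfl⟩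
  have hfl : f l = 1 := by simpa [hfn] using hnl
  simp [hN hn hfn, hL hl hfl]

theorem conj_conj_of_eq_conj {t d d' : G} (h : d = t * d' * t⁻¹) (x : G) :
    d * (t * x * t⁻¹) * d⁻¹ = t * (d' * x * d'⁻¹) * t⁻¹ := by
  rw [h]; group

theorem conj_braid {t m : G} (g : G) (h : t * m * t⁻¹ = m * t * m) :
    g * t * g⁻¹ * (g * m * g⁻¹) * (g * t * g⁻¹)⁻¹ =
      g * m * g⁻¹ * (g * t * g⁻¹) * (g * m * g⁻¹) := by
  rw [conj_inv, conj_mul, conj_mul, h, conj_mul, conj_mul]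

theorem conj_eq_of_mul_pow_three_eq_one {s t : G} (hs : s * s = 1) (ht : t * t = 1)
    (hst : (s * t) ^ 3 = 1) : s * t * s⁻¹ = t * s * t := by
  have h : s * t * s * (t * s * t) = 1 := by
    simpa only [pow_succ, pow_zero, one_mul, mul_assoc] using hst
  rw [inv_eq_of_mul_eq_one_left hs, eq_inv_of_mul_eq_one_left h, mul_inv_rev, mul_inv_rev,
    inv_eq_of_mul_eq_one_left hs, inv_eq_of_mul_eq_one_left ht]
  group

end Group

section Matrices

variable {K : Type*} [Field K]

/-- The matrices mapping the lines `⟨e₁⟩` and `⟨e₃⟩` to themselves, parametrized so that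
`matD t v a b` is the product of `1 + t E₁₂ + v E₃₂` and `diag(a, b, (ab)⁻¹)`. -/
def matD (t v : K) (a b : Kˣ) : SL(3, K) :=
  ⟨!![(a : K), t * b, 0; 0, b, 0; 0, v * b, ((a : K) * b)⁻¹], by
    simp [Matrix.det_fin_three, mul_assoc]⟩

@[simp]
theorem coe_matD (t v : K) (a b : Kˣ) : (matD t v a b : Matrix (Fin 3) (Fin 3) K) =
    !![(a : K), t * b, 0; 0, b, 0; 0, v * b, ((a : K) * b)⁻¹] := rfl

@[simp]
theorem coe_matJ : (matJ K : Matrix (Fin 3) (Fin 3) K) =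
    !![0, -1, 0; -1, 0, 0; 0, 0, -1] := rfl

@[simp]
theorem coe_matT : (matT K : Matrix (Fin 3) (Fin 3) K) =
    !![0, 0, -1; 0, -1, 0; -1, 0, 0] := rfl

theorem matR_eq_matD (a : Kˣ) : matR a = matD 0 0 a 1 :=
  Subtype.ext (by simp [matR])

theorem matS_eq_matD : matS K = matD 1 0 (-1) 1 :=
  Subtype.ext (by simp [matS])

theorem matD_one : matD (0 : K) 0 1 1 = 1 :=
  Subtype.ext (by simp [Matrix.one_fin_three])

theorem matD_mul (t v t' v' : K) (a b a' b' : Kˣ) :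
    matD t v a b * matD t' v' a' b' =
      matD (t + a / b * t') (v + v' / (a * b ^ 2)) (a * a') (b * b') := by
  refine Subtype.ext ?_
  have h₁₂ : (a : K) * (t' * b') + t * b * b' = (t + a / b * t') * (b * b') := by
    field_simp; ring
  have h₃₂ : v * b * b' + (b : K)⁻¹ * (a : K)⁻¹ * (v' * b') =
      (v + v' / (a * b ^ 2)) * (b * b') := by
    field_simp
  have h₃₃ : (b : K)⁻¹ * (a : K)⁻¹ * ((b' : K)⁻¹ * (a' : K)⁻¹) =
      (b' : K)⁻¹ * (b : K)⁻¹ * ((a' : K)⁻¹ * (a : K)⁻¹) := by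
    ring
  simp [h₁₂, h₃₂, h₃₃]

theorem matD_inv (t v : K) (a b : Kˣ) :
    (matD t v a b)⁻¹ = matD (-(b / a * t)) (-(v * (a * b ^ 2))) a⁻¹ b⁻¹ := by
  rw [inv_eq_iff_mul_eq_one, matD_mul, ← matD_one]
  congr 1
  · field_simp; ring
  · field_simp; ring
  · exact mul_inv_cancel a
  · exact mul_inv_cancel b

theorem matD_inj {t v t' v' : K} {a b a' b' : Kˣ}
    (h : matD t v a b = matD t' v' a' b') : t = t' ∧ v = v' ∧ a = a' ∧ b = b' := by
  have entry (i j : Fin 3) := congrArg (fun M : SL(3, K) => M.1 i j) h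
  have ha : a = a' := Units.ext (by simpa using entry 0 0)
  have hb : b = b' := Units.ext (by simpa using entry 1 1)
  subst ha hb
  exact ⟨by simpa using entry 0 1, by simpa using entry 2 1, rfl, rfl⟩

/-- The lower unitriangular matrix with last row `(u, v, 1)`. -/
def matN (u v : K) : SL(3, K) :=
  ⟨!![1, 0, 0; 0, 1, 0; u, v, 1], by simp [Matrix.det_fin_three]⟩

@[simp]
theorem coe_matN (u v : K) : (matN u v : Matrix (Fin 3) (Fin 3) K) =
    !![1, 0, 0; 0, 1, 0; u, v, 1] := rfl

theorem matN_mul (u v u' v' : K) : matN u v * matN u' v' = matN (u + u') (v + v') :=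
  Subtype.ext (by simp)

theorem matN_zero : matN (0 : K) 0 = 1 :=
  Subtype.ext (by simp [Matrix.one_fin_three])

theorem matD_conj_matN (t u v : K) :
    matD t 0 1 1 * matN u v * (matD t 0 1 1)⁻¹ = matN u (v - t * u) := by
  rw [mul_inv_eq_iff_eq_mul]
  exact Subtype.ext (by simp [mul_comm])

theorem lift_wR (a : Kˣ) : FreeGroup.lift Gen.toSL (wR a) = matD 0 0 a 1 := by
  by_cases ha : a = 1
  · simp [wR, ha, matD_one]
  · simp [wR, ha, Gen.toSL, matR_eq_matD]

theorem lift_wS : FreeGroup.lift Gen.toSL (wS K) = matD 1 0 (-1) 1 := by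
  simp [wS, Gen.toSL, matS_eq_matD]

theorem lift_wJ : FreeGroup.lift Gen.toSL (wJ K) = matJ K := by
  simp [wJ, Gen.toSL]

theorem lift_wT : FreeGroup.lift Gen.toSL (wT K) = matT K := by
  simp [wT, Gen.toSL]

theorem lift_wZ (a : Kˣ) : FreeGroup.lift Gen.toSL (wZ a) = matD 0 0 a a := by
  by_cases ha : a = 1
  · simp [wZ, ha, matD_one]
  · simp only [wZ, ha, if_false, map_pow, map_mul, lift_wJ, lift_wR]
    exact Subtype.ext (by simp [pow_two, mul_comm])

theorem lift_wE (a : Kˣ) : FreeGroup.lift Gen.toSL (wE a) = matD (a : K) 0 1 1 := by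
  simp [wE, lift_wR, lift_wS, matD_mul, matD_inv]

theorem lift_wW : FreeGroup.lift Gen.toSL (wW K) = matD 0 1 (-1) 1 := by
  simp only [wW, map_mul, lift_wT, lift_wS]
  exact Subtype.ext (by simp)

theorem matD_pow (a b : Kˣ) (n : ℕ) : matD (0 : K) 0 a b ^ n = matD 0 0 (a ^ n) (b ^ n) := by
  induction n with
  | zero => simp [matD_one]
  | succ n ih => simp [pow_succ, ih, matD_mul]

theorem lift_eq_of_rel {𝓡 : Set Kˣ} {u v : FreeGroup (Gen K)} (h : Rel 𝓡 u v) :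
    FreeGroup.lift Gen.toSL u = FreeGroup.lift Gen.toSL v := by
  cases h <;>
    simp only [map_mul, map_inv, map_pow, map_one, commutatorElement_def, wRho, wLambda,
      mul_inv_eq_iff_eq_mul, lift_wR, lift_wS, lift_wJ, lift_wT, lift_wZ, lift_wE, lift_wW,
      matD_pow, matD_inv]
  case R_mul => simp [matD_mul]
  case Z_mul => simp [matD_mul]
  case comm_R_Z => simp [matD_mul, matD_one, mul_comm]
  case comm_S_Z => simp [matD_mul, matD_one]
  case comm_S_R => simp [matD_mul, oneSub, sub_eq_add_neg, add_comm]
  case comm_Z_T => exact Subtype.ext (by simp [pow_succ, mul_assoc])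
  case WJRW => exact Subtype.ext (by simp [pow_succ]; field_simp; simp)
  all_goals exact Subtype.ext (by simp [pow_succ, Matrix.one_fin_three])

theorem coe_matJ_mul_mul_matJ (M : SL(3, K)) :
    (matJ K * M * matJ K : SL(3, K)).1 = M.1.submatrix (Equiv.swap 0 1) (Equiv.swap 0 1) := by
  ext i j
  fin_cases i <;> fin_cases j <;>
    simp [Matrix.vecMul_eq_sum, Fin.sum_univ_three, Equiv.swap_apply_of_ne_of_ne]

theorem coe_matT_mul_mul_matT (M : SL(3, K)) :
    (matT K * M * matT K : SL(3, K)).1 = M.1.submatrix (Equiv.swap 0 2) (Equiv.swap 0 2) := by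
  ext i j
  fin_cases i <;> fin_cases j <;>
    simp [Matrix.vecMul_eq_sum, Fin.sum_univ_three, Equiv.swap_apply_of_ne_of_ne]

theorem submatrix_transvection {ι R : Type*} [DecidableEq ι] [CommRing R] (e : Equiv.Perm ι)
    (i j : ι) (c : R) :
    (Matrix.transvection i j c).submatrix e e = Matrix.transvection (e⁻¹ i) (e⁻¹ j) c := by
  ext k l
  simp [Matrix.transvection, Matrix.one_apply, Matrix.single_apply, Equiv.symm_apply_eq]

theorem transvection_mem_of_zero_one_mem {Γ : Subgroup SL(3, K)} (hJ : matJ K ∈ Γ)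
    (hT : matT K ∈ Γ)
    (h : ∀ c : K, Matrix.SpecialLinearGroup.transvection (zero_ne_one (α := Fin 3)) c ∈ Γ)
    {i j : Fin 3} (hij : i ≠ j) (c : K) : Matrix.SpecialLinearGroup.transvection hij c ∈ Γ := by
  let rootMem (i j : Fin 3) : Prop :=
    ∀ (hij : i ≠ j) (c : K), Matrix.SpecialLinearGroup.transvection hij c ∈ Γ
  have swap_J {i j : Fin 3} (h : rootMem i j) :
      rootMem (Equiv.swap 0 1 i) (Equiv.swap 0 1 j) := fun hij c => by
    convert mul_mem (mul_mem hJ (h (ne_of_apply_ne _ hij) c)) hJ using 1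
    refine Subtype.ext (.symm ?_)
    rw [coe_matJ_mul_mul_matJ]
    exact submatrix_transvection (Equiv.swap 0 1) i j c
  have swap_T {i j : Fin 3} (h : rootMem i j) :
      rootMem (Equiv.swap 0 2 i) (Equiv.swap 0 2 j) := fun hij c => by
    convert mul_mem (mul_mem hT (h (ne_of_apply_ne _ hij) c)) hT using 1
    refine Subtype.ext (.symm ?_)
    rw [coe_matT_mul_mul_matT]
    exact submatrix_transvection (Equiv.swap 0 2) i j c
  have h01 : rootMem 0 1 := fun _ => h
  have h21 : rootMem 2 1 := swap_T h01
  have h20 : rootMem 2 0 := swap_J h21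
  have h02 : rootMem 0 2 := swap_T h20
  have h12 : rootMem 1 2 := swap_J h02
  have h10 : rootMem 1 0 := swap_T h12
  fin_cases i <;> fin_cases j
  exacts [absurd rfl hij, h01 hij c, h02 hij c, h10 hij c, absurd rfl hij, h12 hij c, h20 hij c,
    h21 hij c, absurd rfl hij]

theorem lift_toSL_surjective : Function.Surjective (FreeGroup.lift (Gen.toSL (K := K))) := by
  have transvection_zero_one_mem (c : K) :
      Matrix.SpecialLinearGroup.transvection (zero_ne_one (α := Fin 3)) c ∈
        (FreeGroup.lift (Gen.toSL (K := K))).range := by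
    by_cases hc : c = 0
    · simp [hc]
    · refine ⟨wE (Units.mk0 c hc), ?_⟩
      rw [lift_wE]
      ext i j
      fin_cases i <;> fin_cases j <;>
        simp [Matrix.SpecialLinearGroup.transvection_coe]
  have matD_mem (a b : Kˣ) : matD (0 : K) 0 a b ∈ (FreeGroup.lift (Gen.toSL (K := K))).range :=
    ⟨wR (a / b) * wZ b, by simp [lift_wR, lift_wZ, matD_mul]⟩
  rw [← MonoidHom.range_eq_top, eq_top_iff]
  rintro M -
  induction M using Matrix.SpecialLinearGroup.diagonal_transvection_induction' with
  | @hdiag i j hij c hc =>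
    let u := Units.mk0 c hc
    let D : Fin 3 → Kˣ := fun k => if k = i then u else if k = j then u⁻¹ else 1
    convert matD_mem (D 0) (D 1) using 1
    ext k l
    fin_cases i <;> fin_cases j <;> try contradiction
    all_goals
      fin_cases k <;> fin_cases l <;> simp [Matrix.SpecialLinearGroup.diag2n_coe, D, u, hc]
  | htransvec i j hij c =>
    exact transvection_mem_of_zero_one_mem
      (MonoidHom.mem_range.mpr ⟨wJ K, lift_wJ⟩) (MonoidHom.mem_range.mpr ⟨wT K, lift_wT⟩)
      transvection_zero_one_mem hij c
  | hmul A B hA hB => exact mul_mem hA hB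

end Matrices

section Presentation

variable {K : Type*} [Field K] {𝓡 : Set Kˣ}

/-- The group presented by the generators `Gen K` and the relations `Rel 𝓡`. -/
abbrev Pres (𝓡 : Set Kˣ) : Type _ := PresentedGroup (relators 𝓡)

theorem mk_eq_of_rel {u v : FreeGroup (Gen K)} (h : Rel 𝓡 u v) :
    PresentedGroup.mk (relators 𝓡) u = PresentedGroup.mk (relators 𝓡) v :=
  PresentedGroup.mk_eq_mk_of_mul_inv_mem ⟨u, v, h, rfl⟩

/-- The homomorphism from the presented group to `SL₃(K)` given by the matrices of the
generators. -/
def toSL : Pres 𝓡 →* SL(3, K) :=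
  PresentedGroup.toGroup (f := Gen.toSL) fun _ ⟨_, _, huv, h⟩ => by
    rw [h, map_mul, map_inv, lift_eq_of_rel huv, mul_inv_cancel]

theorem toSL_mk (w : FreeGroup (Gen K)) :
    toSL (PresentedGroup.mk (relators 𝓡) w) = FreeGroup.lift Gen.toSL w := rfl

/-- The class of the word `S` in the presented group. -/
def pS : Pres 𝓡 := PresentedGroup.mk _ (wS K)

/-- The class of the word `J` in the presented group. -/
def pJ : Pres 𝓡 := PresentedGroup.mk _ (wJ K)

/-- The class of the word `T` in the presented group. -/
def pT : Pres 𝓡 := PresentedGroup.mk _ (wT K)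

theorem wR_one : wR (1 : Kˣ) = 1 := dif_pos rfl

theorem wZ_one : wZ (1 : Kˣ) = 1 := if_pos rfl

/-- The class of the word `R(a)` in the presented group, as a homomorphism in `a`. -/
noncomputable def pR : Kˣ →* Pres 𝓡 where
  toFun a := PresentedGroup.mk _ (wR a)
  map_one' := by rw [wR_one, map_one]
  map_mul' a b := by
    by_cases ha : a = 1
    · simp [ha, wR_one]
    by_cases hb : b = 1
    · simp [hb, wR_one]
    exact (mk_eq_of_rel (.R_mul a b ha hb)).symm.trans (map_mul ..)

/-- The class of the word `Z(a)` in the presented group, as a homomorphism in `a`. -/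
noncomputable def pZ : Kˣ →* Pres 𝓡 where
  toFun a := PresentedGroup.mk _ (wZ a)
  map_one' := by rw [wZ_one, map_one]
  map_mul' a b := by
    by_cases ha : a = 1
    · simp [ha, wZ_one]
    by_cases hb : b = 1
    · simp [hb, wZ_one]
    exact (mk_eq_of_rel (.Z_mul a b ha hb)).symm.trans (map_mul ..)

theorem toSL_pJ : toSL (pJ : Pres 𝓡) = matJ K := lift_wJ

theorem toSL_pT : toSL (pT : Pres 𝓡) = matT K := lift_wT

theorem toSL_pR (a : Kˣ) : toSL (pR a : Pres 𝓡) = matD 0 0 a 1 := lift_wR a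

theorem toSL_pZ (a : Kˣ) : toSL (pZ a : Pres 𝓡) = matD 0 0 a a := lift_wZ a

theorem pS_mul_self : pS * pS = (1 : Pres 𝓡) :=
  (pow_two _).symm.trans (mk_eq_of_rel .S_sq)

theorem pJ_mul_self : pJ * pJ = (1 : Pres 𝓡) :=
  (pow_two _).symm.trans (mk_eq_of_rel .J_sq)

theorem pT_mul_self : pT * pT = (1 : Pres 𝓡) :=
  (pow_two _).symm.trans (mk_eq_of_rel .T_sq)

theorem pJ_inv : pJ⁻¹ = (pJ : Pres 𝓡) := inv_eq_of_mul_eq_one_left pJ_mul_self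

theorem pT_inv : pT⁻¹ = (pT : Pres 𝓡) := inv_eq_of_mul_eq_one_left pT_mul_self

theorem pJ_conj_pS : pJ * pS * pJ⁻¹ = (pS * pJ * pS : Pres 𝓡) :=
  conj_eq_of_mul_pow_three_eq_one pJ_mul_self pS_mul_self (mk_eq_of_rel .JS_cube)

theorem pT_conj_pJ : pT * pJ * pT⁻¹ = (pJ * pT * pJ : Pres 𝓡) :=
  conj_eq_of_mul_pow_three_eq_one pT_mul_self pJ_mul_self (mk_eq_of_rel .TJ_cube)

theorem commute_pR_pR (a b : Kˣ) : Commute (pR a) (pR b : Pres 𝓡) :=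
  (Commute.all a b).map pR

theorem commute_pR_pZ (a b : Kˣ) : Commute (pR a) (pZ b : Pres 𝓡) := by
  by_cases ha : a = 1
  · simp [ha]
  by_cases hb : b = 1
  · simp [hb]
  exact commutatorElement_eq_one_iff_commute.mp (mk_eq_of_rel (.comm_R_Z a b ha hb))

theorem commute_pS_pZ (a : Kˣ) : Commute pS (pZ a : Pres 𝓡) := by
  by_cases ha : a = 1
  · simp [ha]
  exact commutatorElement_eq_one_iff_commute.mp (mk_eq_of_rel (.comm_S_Z a ha))

theorem pJ_conj_pR (a : Kˣ) : pJ * pR a * pJ⁻¹ = (pR a⁻¹ * pZ a : Pres 𝓡) := by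
  have hZ : pZ a = pJ * pR a * pJ⁻¹ * (pR a : Pres 𝓡) := by
    by_cases ha : a = 1
    · simp [ha]
    have h : pZ a = (pJ * pR a : Pres 𝓡) ^ 2 :=
      congrArg (PresentedGroup.mk (relators 𝓡)) (if_neg ha)
    rw [h, pow_two, pJ_inv, mul_assoc (pJ * pR a)]
  rw [map_inv, (commute_pR_pZ a a).inv_left.eq, hZ, mul_inv_cancel_right]

theorem pJ_conj_pZ (a : Kˣ) : pJ * pZ a * pJ⁻¹ = (pZ a : Pres 𝓡) := by
  have hZ : (pZ a : Pres 𝓡) = pR a * (pJ * pR a * pJ⁻¹) := by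
    rw [pJ_conj_pR, map_inv, mul_inv_cancel_left]
  calc (pJ * pZ a * pJ⁻¹ : Pres 𝓡) = pJ * pR a * pJ⁻¹ * (pJ * (pJ * pR a * pJ⁻¹) * pJ⁻¹) := by
        rw [hZ]; group
    _ = pR a⁻¹ * pZ a * pR a := by
        rw [pJ_conj_pR, ← pJ_conj_pR, pJ_inv]
        simp only [mul_assoc, pJ_mul_self, mul_one]
        simp only [← mul_assoc, pJ_mul_self, one_mul]
    _ = pZ a := by rw [mul_assoc, ← (commute_pR_pZ a a).eq, map_inv, inv_mul_cancel_left]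

theorem pT_conj_pR (a : Kˣ) : pT * pR a * pT⁻¹ = (pR a⁻¹ : Pres 𝓡) := by
  by_cases ha : a = 1
  · simp [ha]
  have h : pT * pR a * (pT * pR a) = (1 : Pres 𝓡) :=
    (pow_two _).symm.trans (mk_eq_of_rel (.TR_sq a ha))
  rw [map_inv, pT_inv, eq_inv_iff_mul_eq_one, mul_assoc, h]

theorem pT_conj_pZ (a : Kˣ) : pT * pZ a * pT⁻¹ = (pR (a ^ 3)⁻¹ * pZ a : Pres 𝓡) := by
  by_cases ha : a = 1
  · simp [ha]
  have h : pZ a * (pT * (pZ a)⁻¹ * pT⁻¹) = (pR (a ^ 3) : Pres 𝓡) := by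
    have : ⁅pZ a, pT⁆ = (pR a ^ 3 : Pres 𝓡) :=
      (map_commutatorElement (PresentedGroup.mk (relators 𝓡)) _ _).symm.trans
        ((mk_eq_of_rel (.comm_Z_T a ha)).trans (map_pow _ _ _))
    rw [map_pow, ← this, commutatorElement_def]; group
  rw [map_inv, ← h]; group

/-- The element of the presented group over `diag(a, b, (ab)⁻¹)`, as a homomorphism in `(a, b)`. -/
noncomputable def torus : Kˣ × Kˣ →* Pres 𝓡 where
  toFun p := pR (p.1 / p.2) * pZ p.2
  map_one' := by simp
  map_mul' p q := by
    rw [Prod.fst_mul, Prod.snd_mul, mul_div_mul_comm, map_mul, map_mul,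
      (commute_pR_pZ _ _).symm.mul_mul_mul_comm]

theorem torus_apply (a b : Kˣ) : torus (a, b) = (pR (a / b) * pZ b : Pres 𝓡) := rfl

theorem pR_eq_torus (a : Kˣ) : pR a = (torus (a, 1) : Pres 𝓡) := by
  simp [torus_apply]

theorem toSL_torus (a b : Kˣ) : toSL (torus (a, b) : Pres 𝓡) = matD 0 0 a b := by
  rw [torus_apply, map_mul, toSL_pR, toSL_pZ, matD_mul]
  simp

theorem pJ_conj_torus (a b : Kˣ) :
    pJ * torus (a, b) * pJ⁻¹ = (torus (b, a) : Pres 𝓡) := by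
  rw [torus_apply, ← conj_mul, pJ_conj_pR, pJ_conj_pZ, mul_assoc, ← map_mul, inv_div,
    div_mul_cancel, torus_apply]

theorem pT_conj_torus (a b : Kˣ) :
    pT * torus (a, b) * pT⁻¹ = (torus ((a * b)⁻¹, b) : Pres 𝓡) := by
  rw [torus_apply, ← conj_mul, pT_conj_pR, pT_conj_pZ, ← mul_assoc, ← map_mul, torus_apply]
  congr 2
  rw [div_eq_mul_inv, div_eq_mul_inv, ← mul_inv, ← mul_inv]
  congr 1
  rw [pow_succ, pow_succ, pow_one]
  group

open Classical in
/-- The root element over the transvection `1 + t E₁₂`: the class of `E₁₂(t)`, and `1` at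
`t = 0`, where the word is not defined. -/
noncomputable def x₁₂ (t : K) : Pres 𝓡 :=
  if h : t = 0 then 1 else PresentedGroup.mk _ (wE (Units.mk0 t h))

theorem x₁₂_zero : x₁₂ 0 = (1 : Pres 𝓡) := dif_pos rfl

theorem x₁₂_coe (a : Kˣ) : x₁₂ (a : K) = PresentedGroup.mk (relators 𝓡) (wE a) := by
  rw [x₁₂, dif_neg a.ne_zero, Units.mk0_val]

theorem toSL_x₁₂ (t : K) : toSL (x₁₂ t : Pres 𝓡) = matD t 0 1 1 := by
  obtain rfl | ⟨a, rfl⟩ := GroupWithZero.eq_zero_or_unit t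
  · rw [x₁₂_zero, map_one, matD_one]
  · rw [x₁₂_coe, toSL_mk, lift_wE]

theorem pR_neg_one_mul_self : pR (-1) * pR (-1) = (1 : Pres 𝓡) := by
  rw [← map_mul, neg_mul_neg, one_mul, map_one]

theorem x₁₂_one : x₁₂ 1 = (pS * pR (-1) : Pres 𝓡) := by
  have h : x₁₂ ((1 : Kˣ) : K) = (pR 1 * pS * (pR (-1))⁻¹ : Pres 𝓡) := by
    rw [x₁₂_coe, wE, map_mul, map_mul, map_inv]; rfl
  simpa only [Units.val_one, map_one, one_mul,
    inv_eq_of_mul_eq_one_left pR_neg_one_mul_self] using h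

theorem pS_eq_x₁₂_one_mul : pS = (x₁₂ 1 * pR (-1) : Pres 𝓡) := by
  rw [x₁₂_one, mul_assoc, pR_neg_one_mul_self, mul_one]

theorem pR_conj_x₁₂ (a : Kˣ) (t : K) : pR a * x₁₂ t * (pR a)⁻¹ = (x₁₂ (a * t) : Pres 𝓡) := by
  have conj_one (c : Kˣ) : x₁₂ (c : K) = (pR c * x₁₂ 1 * (pR c)⁻¹ : Pres 𝓡) := by
    have h : x₁₂ (c : K) = (pR c * pS * (pR (-c))⁻¹ : Pres 𝓡) := by
      rw [x₁₂_coe, wE, map_mul, map_mul, map_inv]; rfl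
    rw [h, pS_eq_x₁₂_one_mul, ← mul_neg_one c, map_mul]
    group
  obtain rfl | ⟨c, rfl⟩ := GroupWithZero.eq_zero_or_unit t
  · simp [x₁₂_zero]
  · rw [← Units.val_mul, conj_one c, conj_one (a * c), map_mul]
    group

theorem commute_pZ_x₁₂ (a : Kˣ) (t : K) : Commute (pZ a) (x₁₂ t : Pres 𝓡) := by
  obtain rfl | ⟨b, rfl⟩ := GroupWithZero.eq_zero_or_unit t
  · simp [x₁₂_zero]
  · have hR (c : Kˣ) : Commute (pZ a) (pR c : Pres 𝓡) := (commute_pR_pZ c a).symm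
    rw [← mul_one (b : K), ← pR_conj_x₁₂, x₁₂_one]
    exact ((hR b).mul_right ((commute_pS_pZ a).symm.mul_right (hR _))).mul_right (hR b).inv_right

theorem torus_conj_x₁₂ (a b : Kˣ) (t : K) :
    torus (a, b) * x₁₂ t * (torus (a, b))⁻¹ = (x₁₂ (a / b * t) : Pres 𝓡) := by
  rw [← Units.val_div_eq_div_val, ← pR_conj_x₁₂, torus_apply, mul_assoc (pR _),
    (commute_pZ_x₁₂ b t).eq]
  group

theorem x₁₂_one_sub_mul {a : Kˣ} (ha : a ≠ 1) :
    x₁₂ (1 - (a : K)) * x₁₂ (a : K) = (x₁₂ 1 : Pres 𝓡) := by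
  have h : x₁₂ (1 - (a : K)) = (pS * pR a * pS⁻¹ * (pR a)⁻¹ : Pres 𝓡) := by
    rw [show 1 - (a : K) = ((oneSub a ha : Kˣ) : K) from rfl, x₁₂_coe]
    exact (mk_eq_of_rel (.comm_S_R a ha)).symm
  have hS : pS * pR a * pS⁻¹ = (x₁₂ 1 * pR a * (x₁₂ 1)⁻¹ : Pres 𝓡) := by
    rw [pS_eq_x₁₂_one_mul, mul_assoc _ (pR (-1)), (commute_pR_pR _ a).eq]
    group
  rw [h, hS, ← mul_one (a : K), ← pR_conj_x₁₂]
  group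

theorem x₁₂_one_mul_neg_one : x₁₂ 1 * x₁₂ (-1) = (1 : Pres 𝓡) := by
  have h : x₁₂ (-1) = (pR (-1) * pS : Pres 𝓡) := by
    have h : pR (-1) * x₁₂ 1 * (pR (-1))⁻¹ = (x₁₂ (-1) : Pres 𝓡) := by simp [pR_conj_x₁₂]
    rw [← h, x₁₂_one, mul_assoc, mul_inv_cancel_right]
  rw [h, ← mul_assoc, ← pS_eq_x₁₂_one_mul, pS_mul_self]

theorem x₁₂_add (t u : K) : x₁₂ (t + u) = (x₁₂ t * x₁₂ u : Pres 𝓡) := by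
  have one_add (s : K) : x₁₂ (1 + s) = (x₁₂ 1 * x₁₂ s : Pres 𝓡) := by
    by_cases hs : s = 0
    · simp [hs, x₁₂_zero]
    by_cases hs1 : 1 + s = 0
    · rw [hs1, x₁₂_zero, eq_neg_of_add_eq_zero_right hs1, x₁₂_one_mul_neg_one]
    let c := Units.mk0 (1 + s) hs1
    let a := Units.mk0 s hs / c
    have ha : a ≠ 1 := by simp [a, c, div_eq_one, Units.ext_iff]
    have c_mul : (c : K) * a = s := by rw [← Units.val_mul, mul_div_cancel]; rfl
    have c_mul_one_sub : (c : K) * (1 - a) = 1 := by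
      rw [mul_one_sub, c_mul]; exact add_sub_cancel_right 1 s
    calc x₁₂ (1 + s) = (pR c * x₁₂ 1 * (pR c)⁻¹ : Pres 𝓡) := by rw [pR_conj_x₁₂, mul_one]; rfl
      _ = x₁₂ 1 * x₁₂ s := by
        rw [← x₁₂_one_sub_mul ha, ← conj_mul, pR_conj_x₁₂, pR_conj_x₁₂, c_mul_one_sub, c_mul,
          x₁₂_one_sub_mul ha]
  obtain rfl | ⟨a, rfl⟩ := GroupWithZero.eq_zero_or_unit t
  · simp [x₁₂_zero]
  have h (s : K) : x₁₂ (a * s) = (pR a * x₁₂ s * (pR a)⁻¹ : Pres 𝓡) := (pR_conj_x₁₂ a s).symm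
  have hu : u = a * (a⁻¹ * u) := by simp
  rw [hu, ← mul_one_add, h, one_add, ← conj_mul, ← h, ← h, mul_one]

theorem x₁₂_neg (t : K) : x₁₂ (-t) = ((x₁₂ t)⁻¹ : Pres 𝓡) := by
  rw [eq_inv_iff_mul_eq_one, ← x₁₂_add, neg_add_cancel, x₁₂_zero]

/-- The root element over the transvection `1 + t E₃₂`. -/
noncomputable def x₃₂ (t : K) : Pres 𝓡 := pT * x₁₂ t * pT⁻¹

/-- The root element over the transvection `1 + t E₃₁`. -/
noncomputable def x₃₁ (t : K) : Pres 𝓡 := pJ * x₃₂ t * pJ⁻¹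

theorem pT_conj_x₃₂ (t : K) : pT * x₃₂ t * pT⁻¹ = (x₁₂ t : Pres 𝓡) := by
  rw [x₃₂, pT_inv, mul_assoc, mul_assoc (pT * _), pT_mul_self, mul_one, ← mul_assoc, pT_mul_self,
    one_mul]

theorem pJ_conj_x₃₁ (t : K) : pJ * x₃₁ t * pJ⁻¹ = (x₃₂ t : Pres 𝓡) := by
  rw [x₃₁, pJ_inv, mul_assoc, mul_assoc (pJ * _), pJ_mul_self, mul_one, ← mul_assoc, pJ_mul_self,
    one_mul]

theorem x₃₂_zero : x₃₂ 0 = (1 : Pres 𝓡) := by simp [x₃₂, x₁₂_zero]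

theorem x₃₁_zero : x₃₁ 0 = (1 : Pres 𝓡) := by simp [x₃₁, x₃₂_zero]

theorem x₃₂_add (t u : K) : x₃₂ (t + u) = (x₃₂ t * x₃₂ u : Pres 𝓡) := by
  rw [x₃₂, x₁₂_add, ← conj_mul, x₃₂, x₃₂]

theorem x₃₁_add (t u : K) : x₃₁ (t + u) = (x₃₁ t * x₃₁ u : Pres 𝓡) := by
  rw [x₃₁, x₃₂_add, ← conj_mul, x₃₁, x₃₁]

theorem x₃₂_neg (t : K) : x₃₂ (-t) = ((x₃₂ t)⁻¹ : Pres 𝓡) := by rw [x₃₂, x₁₂_neg, ← conj_inv, x₃₂]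

theorem x₃₁_neg (t : K) : x₃₁ (-t) = ((x₃₁ t)⁻¹ : Pres 𝓡) := by rw [x₃₁, x₃₂_neg, ← conj_inv, x₃₁]

theorem torus_conj_x₃₂ (a b : Kˣ) (t : K) :
    torus (a, b) * x₃₂ t * (torus (a, b))⁻¹ = (x₃₂ (t / (a * b ^ 2)) : Pres 𝓡) := by
  have h : torus (a, b) = (pT * torus ((a * b)⁻¹, b) * pT⁻¹ : Pres 𝓡) := by
    rw [pT_conj_torus, mul_inv, inv_inv, mul_inv_cancel_right]
  rw [x₃₂, conj_conj_of_eq_conj h, torus_conj_x₁₂, x₃₂]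
  congr 3
  simp only [Units.val_inv_eq_inv_val, Units.val_mul]
  field_simp

theorem torus_conj_x₃₁ (a b : Kˣ) (t : K) :
    torus (a, b) * x₃₁ t * (torus (a, b))⁻¹ = (x₃₁ (t / (a ^ 2 * b)) : Pres 𝓡) := by
  rw [x₃₁, conj_conj_of_eq_conj (pJ_conj_torus b a).symm, torus_conj_x₃₂, x₃₁, mul_comm (b : K)]

/-- The subgroup of the presented group over the upper triangular matrices
`matD t 0 a b`. -/
noncomputable def borel (𝓡 : Set Kˣ) : Subgroup (Pres 𝓡) where
  carrier := {g | ∃ t a b, g = x₁₂ t * torus (a, b)}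
  one_mem' := ⟨0, 1, 1, by rw [x₁₂_zero, one_mul]; exact (map_one torus).symm⟩
  mul_mem' := by
    rintro _ _ ⟨t, a, b, rfl⟩ ⟨u, c, d, rfl⟩
    refine ⟨t + a / b * u, a * c, b * d, ?_⟩
    rw [x₁₂_add, ← torus_conj_x₁₂, ← Prod.mk_mul_mk, map_mul]
    group
  inv_mem' := by
    rintro _ ⟨t, a, b, rfl⟩
    refine ⟨(a⁻¹ : Kˣ) / (b⁻¹ : Kˣ) * -t, a⁻¹, b⁻¹, ?_⟩
    rw [← torus_conj_x₁₂, x₁₂_neg, ← Prod.inv_mk, map_inv]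
    group

theorem x₁₂_mem_borel (t : K) : x₁₂ t ∈ borel 𝓡 :=
  ⟨t, 1, 1, by rw [← Prod.one_eq_mk, map_one, mul_one]⟩

theorem torus_mem_borel (p : Kˣ × Kˣ) : torus p ∈ borel 𝓡 :=
  ⟨0, p.1, p.2, by rw [x₁₂_zero, one_mul]⟩

theorem pR_mem_borel (a : Kˣ) : pR a ∈ borel 𝓡 := pR_eq_torus (𝓡 := 𝓡) a ▸ torus_mem_borel _

theorem pZ_mem_borel (a : Kˣ) : pZ a ∈ borel 𝓡 := by
  have h : torus (a, a) = (pZ a : Pres 𝓡) := by simp [torus_apply]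
  exact h ▸ torus_mem_borel _

theorem pS_mem_borel : pS ∈ borel 𝓡 :=
  pS_eq_x₁₂_one_mul (𝓡 := 𝓡) ▸ mul_mem (x₁₂_mem_borel 1) (pR_mem_borel (-1))

theorem toSL_x₁₂_mul_torus (t : K) (a b : Kˣ) :
    toSL (x₁₂ t * torus (a, b) : Pres 𝓡) = matD t 0 a b := by
  rw [map_mul, toSL_x₁₂, toSL_torus, matD_mul]
  simp

theorem disjoint_borel_ker : Disjoint (borel 𝓡) toSL.ker := by
  rw [Subgroup.disjoint_def]
  rintro _ ⟨t, a, b, rfl⟩ h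
  rw [MonoidHom.mem_ker, toSL_x₁₂_mul_torus, ← matD_one] at h
  obtain ⟨rfl, -, rfl, rfl⟩ := matD_inj h
  rw [x₁₂_zero, one_mul, ← Prod.one_eq_mk, map_one]

theorem pJ_conj_mem_of_mem_borel {p : Pres 𝓡} (hp : p ∈ borel 𝓡) :
    pJ * p * pJ⁻¹ ∈ borel 𝓡 ∨
      pJ * p * pJ⁻¹ ∈ DoubleCoset.doubleCoset pJ (borel 𝓡 : Set (Pres 𝓡)) (borel 𝓡) := by
  obtain ⟨t, a, b, rfl⟩ := hp
  have conj_torus_mem (q : Kˣ × Kˣ) : pJ * torus q * pJ⁻¹ ∈ borel 𝓡 := by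
    rw [pJ_conj_torus]
    exact torus_mem_borel _
  obtain rfl | ⟨c, rfl⟩ := GroupWithZero.eq_zero_or_unit t
  · left
    rw [x₁₂_zero, one_mul]
    exact conj_torus_mem _
  · right
    have h : x₁₂ (c : K) * torus (a, b) =
        (torus (c, 1) * pS * torus ((-1, 1) * (c, 1)⁻¹ * (a, b)) : Pres 𝓡) := by
      rw [← mul_one (c : K), ← pR_conj_x₁₂, x₁₂_one, map_mul, map_mul, map_inv, ← pR_eq_torus,
        ← pR_eq_torus]
      group
    rw [h]
    exact conj_mem_doubleCoset_of_braid pS_mem_borel pJ_conj_pS (conj_torus_mem _)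
      (conj_torus_mem _)

/-- The subgroup of the presented group over the block diagonal matrices
`[[*, *, 0], [*, *, 0], [0, 0, *]]`. -/
noncomputable def levi (𝓡 : Set Kˣ) : Subgroup (Pres 𝓡) :=
  Subgroup.closure (insert pJ (borel 𝓡 : Set (Pres 𝓡)))

theorem borel_le_levi : borel 𝓡 ≤ levi 𝓡 :=
  fun _ hp => Subgroup.subset_closure (Set.mem_insert_of_mem _ hp)

theorem pJ_mem_levi : pJ ∈ levi 𝓡 := Subgroup.subset_closure (Set.mem_insert _ _)

theorem disjoint_levi_ker : Disjoint (levi 𝓡) toSL.ker := by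
  refine disjoint_closure_insert_ker toSL pJ_mul_self (fun _ => pJ_conj_mem_of_mem_borel)
    disjoint_borel_ker ?_
  rintro ⟨_, ⟨t, a, b, rfl⟩, h⟩
  rw [toSL_x₁₂_mul_torus, toSL_pJ] at h
  simpa using congrArg (fun M : SL(3, K) => M.1 1 0) h

theorem toSL_x₃₂ (t : K) : toSL (x₃₂ t : Pres 𝓡) = matN 0 t := by
  rw [x₃₂, pT_inv, map_mul, map_mul, toSL_pT, toSL_x₁₂]
  exact Subtype.ext (by simp)

theorem toSL_x₃₁ (t : K) : toSL (x₃₁ t : Pres 𝓡) = matN t 0 := by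
  rw [x₃₁, pJ_inv, map_mul, map_mul, toSL_pJ, toSL_x₃₂]
  exact Subtype.ext (by simp)

theorem pT_conj_pS : pT * pS * pT⁻¹ = (x₃₂ 1 * pR (-1) : Pres 𝓡) := by
  rw [pS_eq_x₁₂_one_mul, ← conj_mul, pT_conj_pR, x₃₂]
  simp

/-- `𝓡` meets every coset of the subgroup of cubes. -/
def MeetsCubeCosets (𝓡 : Set Kˣ) : Prop :=
  ∀ c : Kˣ, ∃ a ∈ 𝓡, ∃ b : Kˣ, c = a * b ^ 3

theorem IsCubeReps.meetsCubeCosets (h𝓡 : IsCubeReps 𝓡) : MeetsCubeCosets 𝓡 := by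
  intro c
  obtain ⟨a, ha, hac⟩ := h𝓡.surjOn (Set.mem_univ (c : Kˣ ⧸ (powMonoidHom 3 : Kˣ →* Kˣ).range))
  obtain ⟨b, hb⟩ := QuotientGroup.eq.mp hac
  exact ⟨a, ha, b, eq_mul_of_inv_mul_eq hb.symm⟩

theorem commute_x₃₂_one_x₁₂ {a : Kˣ} (ha : a ∈ 𝓡) : Commute (x₃₂ 1) (x₁₂ (a : K) : Pres 𝓡) := by
  set w : Pres 𝓡 := pT * pS * pT⁻¹ with hw
  have hww : w * w = 1 := by rw [conj_mul, pS_mul_self, mul_one, mul_inv_cancel]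
  have hwx : w * x₁₂ (a : K) * (w * x₁₂ (a : K)) = 1 := by
    rw [hw, pT_inv, x₁₂_coe]
    exact (pow_two _).symm.trans (mk_eq_of_rel (.WE_sq a ha))
  have conj_w : w * x₁₂ (a : K) * w⁻¹ = (x₁₂ (a : K))⁻¹ := by
    rw [inv_eq_of_mul_eq_one_left hww, eq_inv_iff_mul_eq_one, mul_assoc, hwx]
  have conj_pR : pR (-1) * x₁₂ (a : K) * (pR (-1))⁻¹ = ((x₁₂ (a : K))⁻¹ : Pres 𝓡) := by
    rw [pR_conj_x₁₂, ← x₁₂_neg]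
    simp
  have conj_x₃₂ : x₃₂ 1 * (x₁₂ (a : K))⁻¹ * (x₃₂ 1)⁻¹ = ((x₁₂ (a : K))⁻¹ : Pres 𝓡) := by
    calc x₃₂ 1 * (x₁₂ (a : K))⁻¹ * (x₃₂ 1)⁻¹ = (w * x₁₂ (a : K) * w⁻¹ : Pres 𝓡) := by
          rw [← conj_pR, hw, pT_conj_pS]; group
      _ = _ := conj_w
  exact Commute.inv_right_iff.mp (mul_inv_eq_iff_eq_mul.mp conj_x₃₂)

theorem commute_x₃₂_x₁₂ (h𝓡 : MeetsCubeCosets 𝓡) (s t : K) :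
    Commute (x₃₂ s) (x₁₂ t : Pres 𝓡) := by
  obtain rfl | ⟨s, rfl⟩ := GroupWithZero.eq_zero_or_unit s
  · simp [x₃₂_zero]
  obtain rfl | ⟨t, rfl⟩ := GroupWithZero.eq_zero_or_unit t
  · simp [x₁₂_zero]
  obtain ⟨a, ha, b, hab⟩ := h𝓡 (s * t)
  have hs : x₃₂ (s : K) =
      (torus (t / (a * b), b⁻¹) * x₃₂ 1 * (torus (t / (a * b), b⁻¹))⁻¹ : Pres 𝓡) := by
    rw [torus_conj_x₃₂]
    congr 1
    have hab' : (s * t : K) = a * b ^ 3 := congrArg Units.val hab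
    simp only [Units.val_inv_eq_inv_val, Units.val_mul, Units.val_div_eq_div_val]
    field_simp
    rw [hab']
  have ht : x₁₂ (t : K) =
      (torus (t / (a * b), b⁻¹) * x₁₂ (a : K) * (torus (t / (a * b), b⁻¹))⁻¹ : Pres 𝓡) := by
    rw [torus_conj_x₁₂]
    congr 1
    simp only [Units.val_inv_eq_inv_val, Units.val_mul, Units.val_div_eq_div_val]
    field_simp
  rw [hs, ht]
  exact (Commute.conj_iff _).mpr (commute_x₃₂_one_x₁₂ ha)

theorem exists_mem_levi_relation {a : Kˣ} (ha : a ∈ 𝓡) : ∃ l ∈ levi 𝓡,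
    x₃₂ 1 * pR (-1) * pJ * pR a * (x₃₂ 1 * pR (-1)) =
      x₁₂ (-a : K) * pJ * pR a * (x₃₂ 1 * pR (-1)) * l := by
  refine ⟨PresentedGroup.mk _ (wLambda a), ?_, ?_⟩
  · have hx (c : Kˣ) : PresentedGroup.mk _ (wE c) ∈ levi 𝓡 :=
      x₁₂_coe (𝓡 := 𝓡) c ▸ borel_le_levi (x₁₂_mem_borel _)
    have hR : pR a ∈ levi 𝓡 := borel_le_levi (pR_mem_borel a)
    have hZ : pZ a ∈ levi 𝓡 := borel_le_levi (pZ_mem_borel a)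
    exact mul_mem (mul_mem (mul_mem (mul_mem (hx _) pJ_mem_levi) (hx _)) (pow_mem hR 4))
      (inv_mem (pow_mem hZ 2))
  · have h := mk_eq_of_rel (.WJRW a ha)
    rw [← Units.val_neg, x₁₂_coe, ← pT_conj_pS, pT_inv]
    exact h

theorem x₁₂_neg_conj_x₃₁_inv {a : Kˣ} (ha : a ∈ 𝓡) :
    x₁₂ (-a : K) * x₃₁ (a : K)⁻¹ * (x₁₂ (-a : K))⁻¹ = (x₃₂ 1 * x₃₁ (a : K)⁻¹ : Pres 𝓡) := by
  obtain ⟨l, hl, hrel⟩ := exists_mem_levi_relation ha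
  set g : Pres 𝓡 := pR (-1) * pJ * pR a with hg
  set ρ : Pres 𝓡 := x₁₂ (-a : K) * pJ * pR a with hρ
  have conj_pJ_pR : pJ * (pR a * x₃₂ 1 * (pR a)⁻¹) * pJ⁻¹ = (x₃₁ (a : K)⁻¹ : Pres 𝓡) := by
    rw [pR_eq_torus, torus_conj_x₃₂, x₃₁]
    simp
  have conj_g : g * x₃₂ 1 * g⁻¹ = x₃₁ (a : K)⁻¹ := by
    calc g * x₃₂ 1 * g⁻¹ =
        pR (-1) * (pJ * (pR a * x₃₂ 1 * (pR a)⁻¹) * pJ⁻¹) * (pR (-1))⁻¹ := by rw [hg]; group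
      _ = x₃₁ (a : K)⁻¹ := by
        rw [conj_pJ_pR, pR_eq_torus, torus_conj_x₃₁]
        simp
  have conj_ρ : ρ * x₃₂ 1 * ρ⁻¹ = x₁₂ (-a : K) * x₃₁ (a : K)⁻¹ * (x₁₂ (-a : K))⁻¹ := by
    rw [hρ, ← conj_pJ_pR]; group
  set k : Pres 𝓡 := ρ * pR (-1) * l * (pR (-1))⁻¹ * g⁻¹ with k_def
  have hk : k ∈ levi 𝓡 := by
    have hJ : pJ ∈ levi 𝓡 := pJ_mem_levi
    have hB {p : Pres 𝓡} (hp : p ∈ borel 𝓡) : p ∈ levi 𝓡 := borel_le_levi hp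
    have hR (c : Kˣ) : pR c ∈ levi 𝓡 := hB (pR_mem_borel c)
    exact mul_mem (mul_mem (mul_mem (mul_mem (mul_mem (mul_mem (hB (x₁₂_mem_borel _)) hJ) (hR a))
      (hR _)) hl) (inv_mem (hR _))) (inv_mem (mul_mem (mul_mem (hR _) hJ) (hR a)))
  have hρk : ρ * x₃₂ 1 * ρ⁻¹ * k = x₃₂ 1 * (g * x₃₂ 1 * g⁻¹) := by
    calc ρ * x₃₂ 1 * ρ⁻¹ * k = ρ * (x₃₂ 1 * pR (-1)) * l * (pR (-1))⁻¹ * g⁻¹ := by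
          rw [k_def]; group
      _ = x₃₂ 1 * (g * x₃₂ 1 * g⁻¹) := by rw [← hrel, hg]; group
  have hk1 : k = 1 := by
    refine Subgroup.disjoint_def.mp disjoint_levi_ker hk ?_
    have h := congrArg toSL hρk
    simp only [conj_ρ, conj_g, map_mul, map_inv, toSL_x₁₂, toSL_x₃₁, toSL_x₃₂, matD_conj_matN,
      matN_mul] at h
    simpa using h
  rw [← conj_ρ, ← mul_one (_ * _⁻¹), ← hk1, hρk, conj_g]

theorem x₁₂_conj_x₃₁ (h𝓡 : MeetsCubeCosets 𝓡) (t u : K) :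
    x₁₂ t * x₃₁ u * (x₁₂ t)⁻¹ = (x₃₂ (-(t * u)) * x₃₁ u : Pres 𝓡) := by
  obtain rfl | ⟨t, rfl⟩ := GroupWithZero.eq_zero_or_unit t
  · simp [x₁₂_zero, x₃₂_zero]
  obtain rfl | ⟨u, rfl⟩ := GroupWithZero.eq_zero_or_unit u
  · simp [x₃₁_zero, x₃₂_zero]
  obtain ⟨a, ha, b, hab⟩ := h𝓡 (-u / t)
  have hu : (u : K) = -(t * (a * b ^ 3)) := by
    have h : (-u / t : K) = a * b ^ 3 := by simpa using congrArg Units.val hab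
    rw [← h]
    field_simp
  set d : Pres 𝓡 := torus ((a * b)⁻¹, -(b * t)⁻¹) with hd
  have conj_x₁₂ : d * x₁₂ (-a : K) * d⁻¹ = x₁₂ (t : K) := by
    rw [hd, torus_conj_x₁₂]
    congr 1
    simp only [Units.val_inv_eq_inv_val, Units.val_mul, Units.val_neg]
    field_simp
  have conj_x₃₁ : d * x₃₁ (a : K)⁻¹ * d⁻¹ = x₃₁ (u : K) := by
    rw [hd, torus_conj_x₃₁, hu]
    congr 1
    simp only [Units.val_inv_eq_inv_val, Units.val_mul, Units.val_neg]
    field_simp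
  have conj_x₃₂ : d * x₃₂ 1 * d⁻¹ = x₃₂ (-(t * u) : K) := by
    rw [hd, torus_conj_x₃₂, hu]
    congr 1
    simp only [Units.val_inv_eq_inv_val, Units.val_mul, Units.val_neg]
    field_simp
  rw [← conj_x₁₂, ← conj_x₃₂, ← conj_x₃₁, conj_mul, conj_inv, conj_mul, conj_mul,
    x₁₂_neg_conj_x₃₁_inv ha]

theorem commute_x₃₁_x₃₂ (h𝓡 : MeetsCubeCosets 𝓡) (u v : K) :
    Commute (x₃₁ u) (x₃₂ v : Pres 𝓡) := by
  have h : x₁₂ (-v) * x₃₁ u * (x₁₂ (-v))⁻¹ * (x₁₂ (-v) * x₃₁ 1 * (x₁₂ (-v))⁻¹) =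
      (x₁₂ (-v) * x₃₁ (u + 1) * (x₁₂ (-v))⁻¹ : Pres 𝓡) := by
    rw [x₃₁_add, conj_mul]
  rw [x₁₂_conj_x₃₁ h𝓡, x₁₂_conj_x₃₁ h𝓡, x₁₂_conj_x₃₁ h𝓡, x₃₁_add,
    show -(-v * (u + 1)) = -(-v * u) + -(-v * 1) by ring, x₃₂_add] at h
  refine mul_right_cancel (b := x₃₁ 1) ?_
  simpa [mul_assoc] using h

/-- The subgroup of the presented group over the lower unitriangular matrices `matN u v`. -/
noncomputable def unipotent (h𝓡 : MeetsCubeCosets 𝓡) : Subgroup (Pres 𝓡) where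
  carrier := {g | ∃ u v, g = x₃₁ u * x₃₂ v}
  one_mem' := ⟨0, 0, by rw [x₃₁_zero, x₃₂_zero, one_mul]⟩
  mul_mem' := by
    rintro _ _ ⟨u, v, rfl⟩ ⟨u', v', rfl⟩
    refine ⟨u + u', v + v', ?_⟩
    rw [x₃₁_add, x₃₂_add, (commute_x₃₁_x₃₂ h𝓡 u' v).symm.mul_mul_mul_comm]
  inv_mem' := by
    rintro _ ⟨u, v, rfl⟩
    refine ⟨-u, -v, ?_⟩
    rw [x₃₁_neg, x₃₂_neg, mul_inv_rev]
    exact (commute_x₃₁_x₃₂ h𝓡 u v).inv_inv.eq.symm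

theorem toSL_x₃₁_mul_x₃₂ (u v : K) : toSL (x₃₁ u * x₃₂ v : Pres 𝓡) = matN u v := by
  rw [map_mul, toSL_x₃₁, toSL_x₃₂, matN_mul, add_zero, zero_add]

theorem disjoint_unipotent_ker (h𝓡 : MeetsCubeCosets 𝓡) : Disjoint (unipotent h𝓡) toSL.ker := by
  rw [Subgroup.disjoint_def]
  rintro _ ⟨u, v, rfl⟩ h
  rw [MonoidHom.mem_ker, toSL_x₃₁_mul_x₃₂] at h
  have hu : u = 0 := by simpa using congrArg (fun M : SL(3, K) => M.1 2 0) h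
  have hv : v = 0 := by simpa using congrArg (fun M : SL(3, K) => M.1 2 1) h
  rw [hu, hv, x₃₁_zero, x₃₂_zero, one_mul]

theorem borel_le_normalizer_unipotent (h𝓡 : MeetsCubeCosets 𝓡) :
    borel 𝓡 ≤ Subgroup.normalizer (unipotent h𝓡 : Set (Pres 𝓡)) := by
  rw [Subgroup.le_normalizer_iff]
  rintro _ ⟨t, a, b, rfl⟩ _ ⟨u, v, rfl⟩
  have conj_torus : torus (a, b) * (x₃₁ u * x₃₂ v) * (torus (a, b))⁻¹ =
      (x₃₁ (u / (a ^ 2 * b)) * x₃₂ (v / (a * b ^ 2)) : Pres 𝓡) := by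
    rw [← conj_mul, torus_conj_x₃₁, torus_conj_x₃₂]
  have conj_x₁₂ (u v : K) : x₁₂ t * (x₃₁ u * x₃₂ v) * (x₁₂ t)⁻¹ =
      (x₃₁ u * x₃₂ (-(t * u) + v) : Pres 𝓡) := by
    rw [← conj_mul, x₁₂_conj_x₃₁ h𝓡, (commute_x₃₂_x₁₂ h𝓡 v t).symm.mul_inv_cancel,
      ← (commute_x₃₁_x₃₂ h𝓡 _ _).eq, x₃₂_add, mul_assoc]
  refine ⟨u / (a ^ 2 * b), -(t * (u / (a ^ 2 * b))) + v / (a * b ^ 2), ?_⟩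
  rw [← conj_x₁₂, ← conj_torus]
  group

theorem pJ_conj_mem_unipotent (h𝓡 : MeetsCubeCosets 𝓡) {n : Pres 𝓡} (hn : n ∈ unipotent h𝓡) :
    pJ * n * pJ⁻¹ ∈ unipotent h𝓡 := by
  obtain ⟨u, v, rfl⟩ := hn
  refine ⟨v, u, ?_⟩
  rw [← conj_mul, pJ_conj_x₃₁, ← x₃₁, (commute_x₃₁_x₃₂ h𝓡 v u).eq]

theorem levi_le_normalizer_unipotent (h𝓡 : MeetsCubeCosets 𝓡) :
    levi 𝓡 ≤ Subgroup.normalizer (unipotent h𝓡 : Set (Pres 𝓡)) := by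
  refine (Subgroup.closure_le _).mpr (Set.insert_subset ?_ (borel_le_normalizer_unipotent h𝓡))
  refine Subgroup.mem_normalizer_iff.mpr fun n => ⟨pJ_conj_mem_unipotent h𝓡, fun hn => ?_⟩
  have h : pJ * (pJ * n * pJ⁻¹) * pJ⁻¹ = n := by
    calc pJ * (pJ * n * pJ⁻¹) * pJ⁻¹ = pJ * pJ * n * (pJ * pJ)⁻¹ := by group
      _ = n := by rw [pJ_mul_self]; group
  exact h ▸ pJ_conj_mem_unipotent h𝓡 hn

/-- The subgroup of the presented group over the matrices with last column `(0, 0, *)`. -/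
noncomputable def parabolic (h𝓡 : MeetsCubeCosets 𝓡) : Subgroup (Pres 𝓡) :=
  unipotent h𝓡 ⊔ levi 𝓡

theorem mem_parabolic {h𝓡 : MeetsCubeCosets 𝓡} {p : Pres 𝓡} :
    p ∈ parabolic h𝓡 ↔ ∃ n ∈ unipotent h𝓡, ∃ l ∈ levi 𝓡, n * l = p := by
  rw [← SetLike.mem_coe, parabolic,
    Subgroup.coe_mul_of_right_le_normalizer_left _ _ (levi_le_normalizer_unipotent h𝓡)]
  exact Set.mem_mul

theorem mem_borel_or_mem_doubleCoset_of_mem_levi {l : Pres 𝓡} (hl : l ∈ levi 𝓡) :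
    l ∈ borel 𝓡 ∨ l ∈ DoubleCoset.doubleCoset pJ (borel 𝓡 : Set (Pres 𝓡)) (borel 𝓡) :=
  mem_or_mem_doubleCoset_of_mem_closure_insert pJ_mul_self
    (fun _ => pJ_conj_mem_of_mem_borel) hl

theorem toSL_apply_eq_zero_of_mem_levi {l : Pres 𝓡} (hl : l ∈ levi 𝓡) :
    (toSL l).1 0 2 = 0 ∧ (toSL l).1 2 0 = 0 ∧ (toSL l).1 2 1 = 0 := by
  rcases mem_borel_or_mem_doubleCoset_of_mem_levi hl with ⟨t, a, b, rfl⟩ | hl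
  · simp [toSL_x₁₂_mul_torus, -map_mul]
  · obtain ⟨_, ⟨t, a, b, rfl⟩, _, ⟨t', a', b', rfl⟩, rfl⟩ := DoubleCoset.mem_doubleCoset.mp hl
    rw [map_mul, map_mul, toSL_x₁₂_mul_torus, toSL_x₁₂_mul_torus, toSL_pJ]
    simp

theorem disjoint_parabolic_ker (h𝓡 : MeetsCubeCosets 𝓡) :
    Disjoint (parabolic h𝓡) toSL.ker := by
  refine disjoint_sup_ker toSL (levi_le_normalizer_unipotent h𝓡) (disjoint_unipotent_ker h𝓡)
    disjoint_levi_ker (Subgroup.disjoint_def.mpr ?_)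
  rintro _ ⟨_, ⟨u, v, rfl⟩, rfl⟩ ⟨l, hl, h⟩
  obtain ⟨-, h20, h21⟩ := toSL_apply_eq_zero_of_mem_levi hl
  rw [h, toSL_x₃₁_mul_x₃₂] at h20 h21
  obtain rfl : u = 0 := by simpa using h20
  obtain rfl : v = 0 := by simpa using h21
  rw [toSL_x₃₁_mul_x₃₂, matN_zero]

theorem toSL_apply_zero_two_of_mem_parabolic {h𝓡 : MeetsCubeCosets 𝓡} {p : Pres 𝓡}
    (hp : p ∈ parabolic h𝓡) : (toSL p).1 0 2 = 0 := by
  obtain ⟨_, ⟨u, v, rfl⟩, l, hl, rfl⟩ := mem_parabolic.mp hp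
  rw [map_mul, toSL_x₃₁_mul_x₃₂]
  simpa [Matrix.mul_apply, Fin.sum_univ_three] using (toSL_apply_eq_zero_of_mem_levi hl).1

/-- The conjugate of `pS` by `pJ * pT`; this element is to `pT` and `x₃₁` what `pS` is to `pJ` and
`x₁₂`. -/
def pS₃₁ : Pres 𝓡 := pJ * pT * pS * (pJ * pT)⁻¹

theorem pT_conj_pS₃₁ : pT * pS₃₁ * pT⁻¹ = (pS₃₁ * pT * pS₃₁ : Pres 𝓡) := by
  have hT : pJ * pT * pJ * (pJ * pT)⁻¹ = (pT : Pres 𝓡) := by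
    rw [mul_inv_eq_iff_eq_mul, ← mul_assoc, ← pT_conj_pJ, pT_inv]
  have h := conj_braid (pJ * pT : Pres 𝓡) pJ_conj_pS
  rwa [hT] at h

theorem pS₃₁_eq : pS₃₁ = (x₃₁ 1 * torus (1, -1) : Pres 𝓡) := by
  calc (pS₃₁ : Pres 𝓡) = pJ * (pT * pS * pT⁻¹) * pJ⁻¹ := by rw [pS₃₁]; group
    _ = x₃₁ 1 * torus (1, -1) := by
      rw [pT_conj_pS, ← conj_mul, pR_eq_torus, pJ_conj_torus, x₃₁]

theorem x₃₁_coe (c : Kˣ) : x₃₁ (c : K) =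
    (torus (1, c⁻¹) * pS₃₁ * torus ((1, -1)⁻¹ * (1, c⁻¹)⁻¹) : Pres 𝓡) := by
  have h := torus_conj_x₃₁ (𝓡 := 𝓡) 1 c⁻¹ 1
  rw [pS₃₁_eq, map_mul, map_inv, map_inv, mul_assoc, mul_assoc, mul_inv_cancel_left, ← mul_assoc, h]
  simp

theorem unipotent_le_parabolic (h𝓡 : MeetsCubeCosets 𝓡) : unipotent h𝓡 ≤ parabolic h𝓡 :=
  le_sup_left

theorem levi_le_parabolic (h𝓡 : MeetsCubeCosets 𝓡) : levi 𝓡 ≤ parabolic h𝓡 :=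
  le_sup_right

theorem x₃₂_mem_parabolic (h𝓡 : MeetsCubeCosets 𝓡) (t : K) : x₃₂ t ∈ parabolic h𝓡 :=
  unipotent_le_parabolic h𝓡 ⟨0, t, by rw [x₃₁_zero, one_mul]⟩

theorem x₃₁_mem_parabolic (h𝓡 : MeetsCubeCosets 𝓡) (t : K) : x₃₁ t ∈ parabolic h𝓡 :=
  unipotent_le_parabolic h𝓡 ⟨t, 0, by rw [x₃₂_zero, mul_one]⟩

theorem pS₃₁_mem_parabolic (h𝓡 : MeetsCubeCosets 𝓡) : pS₃₁ ∈ parabolic h𝓡 := by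
  rw [pS₃₁_eq]
  exact mul_mem (x₃₁_mem_parabolic h𝓡 1)
    (levi_le_parabolic h𝓡 (borel_le_levi (torus_mem_borel _)))

theorem pT_conj_x₃₂_mem_parabolic (h𝓡 : MeetsCubeCosets 𝓡) (t : K) :
    pT * x₃₂ t * pT⁻¹ ∈ parabolic h𝓡 := by
  rw [pT_conj_x₃₂]
  exact levi_le_parabolic h𝓡 (borel_le_levi (x₁₂_mem_borel t))

theorem pT_conj_mem_parabolic_of_mem_borel (h𝓡 : MeetsCubeCosets 𝓡) {p : Pres 𝓡}
    (hp : p ∈ borel 𝓡) : pT * p * pT⁻¹ ∈ parabolic h𝓡 := by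
  obtain ⟨t, a, b, rfl⟩ := hp
  rw [← conj_mul, ← x₃₂, pT_conj_torus]
  exact mul_mem (x₃₂_mem_parabolic h𝓡 t) (levi_le_parabolic h𝓡 (borel_le_levi (torus_mem_borel _)))

theorem pT_conj_mul_mem {P : Subgroup (Pres 𝓡)} {p q : Pres 𝓡} (hp : pT * p * pT⁻¹ ∈ P)
    (hq : pT * q * pT⁻¹ ∈ P) : pT * (p * q) * pT⁻¹ ∈ P := by
  rw [← conj_mul]
  exact mul_mem hp hq

theorem pT_conj_mem_of_mem_parabolic {h𝓡 : MeetsCubeCosets 𝓡} {p : Pres 𝓡}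
    (hp : p ∈ parabolic h𝓡) :
    pT * p * pT⁻¹ ∈ parabolic h𝓡 ∨
      pT * p * pT⁻¹ ∈ DoubleCoset.doubleCoset pT (parabolic h𝓡 : Set (Pres 𝓡)) (parabolic h𝓡) := by
  obtain ⟨n, hn, l, hl, rfl⟩ := mem_parabolic.mp hp
  have conj_borel {b : Pres 𝓡} (hb : b ∈ borel 𝓡) : pT * b * pT⁻¹ ∈ parabolic h𝓡 :=
    pT_conj_mem_parabolic_of_mem_borel h𝓡 hb
  have conj_x₃₂ (t : K) : pT * x₃₂ t * pT⁻¹ ∈ parabolic h𝓡 := pT_conj_x₃₂_mem_parabolic h𝓡 t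
  rcases mem_borel_or_mem_doubleCoset_of_mem_levi hl with hb | hl
  · obtain ⟨u, v, rfl⟩ := hn
    obtain rfl | ⟨c, rfl⟩ := GroupWithZero.eq_zero_or_unit u
    · left
      rw [x₃₁_zero, one_mul]
      exact pT_conj_mul_mem (conj_x₃₂ v) (conj_borel hb)
    · right
      rw [mul_assoc (x₃₁ _), x₃₁_coe, mul_assoc (_ * pS₃₁)]
      exact conj_mem_doubleCoset_of_braid (pS₃₁_mem_parabolic h𝓡) pT_conj_pS₃₁
        (conj_borel (torus_mem_borel _))
        (pT_conj_mul_mem (conj_borel (torus_mem_borel _))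
          (pT_conj_mul_mem (conj_x₃₂ v) (conj_borel hb)))
  · obtain ⟨b, hb, b', hb', rfl⟩ := DoubleCoset.mem_doubleCoset.mp hl
    obtain ⟨u, v, h⟩ : b⁻¹ * n * b ∈ unipotent h𝓡 :=
      (Subgroup.mem_normalizer_iff''.mp (borel_le_normalizer_unipotent h𝓡 hb) n).mp hn
    right
    have hp : n * (b * pJ * b') = b * x₃₂ v * pJ * (x₃₂ u * b') := by
      calc n * (b * pJ * b') = b * (b⁻¹ * n * b) * pJ * b' := by group
        _ = b * x₃₂ v * pJ * (pJ⁻¹ * x₃₁ u * pJ * b') := by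
          rw [h, (commute_x₃₁_x₃₂ h𝓡 u v).eq]; group
        _ = b * x₃₂ v * pJ * (x₃₂ u * b') := by rw [x₃₁]; group
    rw [hp]
    exact conj_mem_doubleCoset_of_braid (levi_le_parabolic h𝓡 pJ_mem_levi) pT_conj_pJ
      (pT_conj_mul_mem (conj_borel hb) (conj_x₃₂ v))
      (pT_conj_mul_mem (conj_x₃₂ u) (conj_borel hb'))

theorem closure_insert_pT_parabolic (h𝓡 : MeetsCubeCosets 𝓡) :
    Subgroup.closure (insert pT (parabolic h𝓡 : Set (Pres 𝓡))) = ⊤ := by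
  have le_closure : levi 𝓡 ≤ Subgroup.closure (insert pT (parabolic h𝓡 : Set (Pres 𝓡))) :=
    fun _ hl => Subgroup.subset_closure (Set.mem_insert_of_mem _ (levi_le_parabolic h𝓡 hl))
  rw [eq_top_iff, ← PresentedGroup.closure_range_of, Subgroup.closure_le]
  rintro _ ⟨x, rfl⟩
  cases x with
  | R a ha =>
    have h : PresentedGroup.of (.R a ha) = (pR a : Pres 𝓡) :=
      (congrArg (PresentedGroup.mk (relators 𝓡)) (dif_neg ha : wR a = _)).symm
    exact h ▸ le_closure (borel_le_levi (pR_mem_borel a))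
  | S => exact le_closure (borel_le_levi pS_mem_borel)
  | J => exact le_closure pJ_mem_levi
  | T => exact Subgroup.subset_closure (Set.mem_insert _ _)

theorem toSL_injective (h𝓡 : MeetsCubeCosets 𝓡) :
    Function.Injective (toSL : Pres 𝓡 →* SL(3, K)) := by
  rw [← MonoidHom.ker_eq_bot_iff, ← disjoint_top, disjoint_comm, ← closure_insert_pT_parabolic h𝓡]
  refine disjoint_closure_insert_ker toSL pT_mul_self (fun _ => pT_conj_mem_of_mem_parabolic)
    (disjoint_parabolic_ker h𝓡) ?_
  rintro ⟨p, hp, h⟩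
  simpa [h, toSL_pT] using toSL_apply_zero_two_of_mem_parabolic hp

end Presentation

end SL3Pres

theorem theorem5p6_general {K : Type*} [Field K] (𝓡 : Set Kˣ) (h𝓡 : SL3Pres.MeetsCubeCosets 𝓡) :
    Subgroup.closure (Set.range (SL3Pres.Gen.toSL (K := K))) = ⊤ ∧
      (FreeGroup.lift (SL3Pres.Gen.toSL (K := K))).ker =
        Subgroup.normalClosure (SL3Pres.relators 𝓡) := by
  refine ⟨FreeGroup.lift_surjective_iff_closure_range_eq_top.mp SL3Pres.lift_toSL_surjective, ?_⟩
  ext w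
  rw [← PresentedGroup.mk_eq_one_iff, MonoidHom.mem_ker, ← SL3Pres.toSL_mk (𝓡 := 𝓡),
    map_eq_one_iff _ (SL3Pres.toSL_injective h𝓡)]

theorem theorem5p6 {K : Type*} [Field K] (𝓡 : Set Kˣ) (h𝓡 : SL3Pres.IsCubeReps 𝓡)
    (h1 : (1 : Kˣ) ∈ 𝓡) :
    Subgroup.closure (Set.range (SL3Pres.Gen.toSL (K := K))) = ⊤ ∧
      (FreeGroup.lift (SL3Pres.Gen.toSL (K := K))).ker =
        Subgroup.normalClosure (SL3Pres.relators 𝓡) :=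
  theorem5p6_general 𝓡 h𝓡.meetsCubeCosets
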